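/- All graphs are finite and undirected and may have loops and multiple edges. A graph invariant is a function $f$ from graphs to $\mathbb{C}$ that takes the same value on isomorphic graphs. For a symmetric matrix $A\in\mathbb{C}^{n\times n}$, where $n\in\mathbb{Z}_{\ge 0}$, the partition function $p_A$ is the graph invariant $$p_A(G)=\sum_{\kappa:V\to\{1,\dots,n\}}\ \prod_{uv\in E}A_{\kappa(u),\kappa(v)}\qquad (G=(V,E)),$$ where the product runs over the edges with multiplicity. For an integer $k\ge 0$, a $k$-marked graph is a pair $(G,\mu)$ of a graph $G=(V,E)$ and a (not necessarily injective) function $\mu:\{1,\dots,k\}\to V$. The product $(G,\mu)(H,\nu)$ of two $k$-marked graphs is the graph obtained from the disjoint union of $G$ and $H$ by identifying $\mu(i)$ with $\nu(i)$ for $i=1,\dots,k$, keeping all edges of both graphs. The $k$-th connection matrix $C_{f,k}$ of $f$ is the matrix, with rows and columns indexed by all $k$-marked graphs, with entries $$(C_{f,k})_{(G,\mu),(H,\nu)}=f\big((G,\mu)(H,\nu)\big).$$ Let $\emptyset$ denote the graph with no vertices and no edges. **Theorem.** Let $f$ be a graph invariant. Then $f=p_A$ for some $n\in\mathbb{Z}_{\ge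 0}$ and some symmetric $A\in\mathbb{C}^{n\times n}$ if and only if $f(\emptyset)=1$ and there is a real number $c$ such that, for every integer $k\ge 0$, the matrix $C_{f,k}$ has finite rank and $\operatorname{rank}(C_{f,k})\le c^k$. -/

import Mathlib

/-- A finite undirected graph, possibly with loops and multiple edges: a finite vertex set
together with a finite multiset of unordered pairs of (not necessarily distinct) vertices. -/
structure Multigraph where
  V : Type
  finite : Finite V
  edges : Multiset (Sym2 V)

namespace Multigraph

instance (G : Multigraph) : Finite G.V := G.finite

/-- Two multigraphs are isomorphic if some bijection between the vertex sets carries the edge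
multiset of the first onto the edge multiset of the second. -/
def Isomorphic (G H : Multigraph) : Prop :=
  ∃ e : G.V ≃ H.V, G.edges.map (Sym2.map e) = H.edges

/-- The graph with no vertices and no edges. -/
def empty : Multigraph where
  V := Empty
  finite := inferInstance
  edges := 0

end Multigraph

/-- A graph invariant: a complex-valued function of multigraphs that takes the same value on
isomorphic multigraphs. -/
def IsGraphInvariant (f : Multigraph → ℂ) : Prop :=
  ∀ G H : Multigraph, G.Isomorphic H → f G = f H

/-- The entry `A u v` of a symmetric matrix, as a function of the unordered pair `s(u, v)`. -/
def Matrix.IsSymm.onSym2 {n : ℕ} {A : Matrix (Fin n) (Fin n) ℂ} (hA : A.IsSymm) :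
    Sym2 (Fin n) → ℂ :=
  Sym2.lift ⟨fun i j => A i j, fun i j => hA.apply j i⟩

open Classical in
/-- The partition function of the spin model given by a symmetric matrix `A`: the sum over all
`κ : V → [n]` of the product of `A (κ u) (κ v)` over all edges `uv`, with multiplicity. -/
noncomputable def partitionFunction {n : ℕ} {A : Matrix (Fin n) (Fin n) ℂ} (hA : A.IsSymm)
    (G : Multigraph) : ℂ :=
  letI : Fintype G.V := Fintype.ofFinite G.V
  ∑ κ : G.V → Fin n, (G.edges.map fun e => hA.onSym2 (e.map κ)).prod

/-- A `k`-marked graph: a multigraph with a (not necessarily injective) function from the `k`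
marks to its vertices. -/
structure MarkedGraph (k : ℕ) extends Multigraph where
  mark : Fin k → V

namespace MarkedGraph

variable {k : ℕ}

/-- Equally marked vertices of the two parts of a disjoint union. -/
inductive SameMark (G H : MarkedGraph k) : G.V ⊕ H.V → G.V ⊕ H.V → Prop
  | intro (i : Fin k) : SameMark G H (Sum.inl (G.mark i)) (Sum.inr (H.mark i))

/-- The product of two `k`-marked graphs: the disjoint union, with equally marked vertices
identified (`Quot` divides by the equivalence relation generated by `SameMark`) and with all
edges of both graphs kept. -/
def glue (G H : MarkedGraph k) : Multigraph where
  V := Quot (SameMark G H)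
  finite := Finite.of_surjective (Quot.mk (SameMark G H)) Quot.mk_surjective
  edges := G.edges.map (Sym2.map fun v => Quot.mk (SameMark G H) (Sum.inl v)) +
    H.edges.map (Sym2.map fun v => Quot.mk (SameMark G H) (Sum.inr v))

end MarkedGraph

/-- The `k`-th connection matrix of `f`, with rows and columns indexed by all `k`-marked
graphs. -/
def connectionMatrix (f : Multigraph → ℂ) (k : ℕ) :
    Matrix (MarkedGraph k) (MarkedGraph k) ℂ :=
  Matrix.of fun G H => f (G.glue H)

/-! Necessity: a colouring of a product of marked graphs is a pair of colourings agreeing on the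
marks, so `C_{f,k}` factors through the `n ^ k` colourings of the marks. Sufficiency: graphs with
all vertices labelled by `L` form a commutative monoid under gluing. In its algebra modulo the
radical `null f L`, each `ident a b` is idempotent, and `sep a` forces the labels `a i` apart. If
`sep a * y` has nonzero value for a `k`-tuple `a`, attaching `m` new labels to the `a i` in all `k ^
m` ways gives orthogonal elements, whence `k ^ m ≤ c ^ (|L| + m)` for all `m`, which bounds `k`
(`pow_le_of_eval_sep_ne_zero`). So let `n + 1` be the least length at which separation always
evaluates to zero. Next to `n` separated labels, any further label is then the sum of its
identifications with them (`mk_sep_mul_sum`). Applied to all vertices of a disjoint graph `G`, and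
with `f` multiplicative (rank at most 1 at `k = 0`), this gives `f G` as a sum over `n`-colourings,
with the edges among the `n` labels as formal variables. The relations generate a proper ideal; by
the Nullstellensatz it has a complex zero, and this zero is `A`. -/

/-- A presentation of a graph whose vertices are all labelled by `L`: a multiset of pairs of
labels to be identified and a multiset of edges. -/
abbrev Presentation (L : Type) : Type := Multiset (Sym2 L) × Multiset (Sym2 L)

/-! ### Labelled graphs and their gluing -/

namespace Presentation

variable {L L' W : Type}

/-- Labels which a presentation identifies directly. -/
def Rel (p : Presentation L) (i j : L) : Prop := s(i, j) ∈ p.1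

/-- The graph given by a presentation. -/
def graph [Finite L] (p : Presentation L) : Multigraph where
  V := Quot p.Rel
  finite := Finite.of_surjective (Quot.mk p.Rel) Quot.mk_surjective
  edges := p.2.map (Sym2.map (Quot.mk p.Rel))

/-- A map from the labels onto the vertices of `H` which identifies just the labels that the
presentation identifies gives an isomorphism. -/
theorem graph_isomorphic [Finite L] (p : Presentation L) (H : Multigraph) (F : L → H.V)
    (hF : ∀ i j, s(i, j) ∈ p.1 → F i = F j) (ψ : H.V → Quot p.Rel)
    (hψ : ∀ i, ψ (F i) = Quot.mk _ i) (hsurj : F.Surjective)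
    (hE : p.2.map (Sym2.map F) = H.edges) : p.graph.Isomorphic H := by
  refine ⟨⟨Quot.lift F hF, ψ, ?_, ?_⟩, ?_⟩
  · rintro ⟨i⟩
    exact hψ i
  · intro v
    obtain ⟨i, rfl⟩ := hsurj v
    simp [hψ]
  · rw [← hE]
    simp only [graph, Multiset.map_map, Function.comp_apply, Sym2.map_map]
    rfl

/-- Marking the vertices of a presented graph by labels. -/
def marked [Finite L] {k : ℕ} (e : Fin k → L) (p : Presentation L) : MarkedGraph k where
  toMultigraph := p.graph
  mark i := Quot.mk _ (e i)

/-- Every label is a mark, so gluing merges both identification relations. Thus addition of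
presentations realises the product in the connection matrix. -/
theorem graph_add_isomorphic [Finite L] {k : ℕ} (e : Fin k ≃ L) (p q : Presentation L) :
    (p + q).graph.Isomorphic ((p.marked e).glue (q.marked e)) := by
  have key : ∀ i : L, (Quot.mk (MarkedGraph.SameMark (p.marked e) (q.marked e))
      (Sum.inl (Quot.mk p.Rel i))) = Quot.mk _ (Sum.inr (Quot.mk q.Rel i)) := by
    intro i
    have := Quot.sound (MarkedGraph.SameMark.intro (G := p.marked e) (H := q.marked e) (e.symm i))
    simp only [marked, Equiv.apply_symm_apply] at this
    exact this
  refine graph_isomorphic _ _ (fun i => Quot.mk _ (Sum.inl (Quot.mk p.Rel i))) ?_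
    (Quot.lift (Sum.elim (Quot.map id ?_) (Quot.map id ?_)) ?_) ?_ ?_ ?_
  · intro i j h
    rcases Multiset.mem_add.1 h with h | h
    · rw [Quot.sound (r := p.Rel) h]
    · rw [key, key, Quot.sound (r := q.Rel) h]
  · exact fun i j h => Multiset.mem_add.2 (Or.inl h)
  · exact fun i j h => Multiset.mem_add.2 (Or.inr h)
  · rintro _ _ ⟨i⟩
    rfl
  · intro i
    rfl
  · rintro ⟨i | i⟩ <;> obtain ⟨i, rfl⟩ := Quot.exists_rep i
    · exact ⟨i, rfl⟩
    · exact ⟨i, key i⟩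
  · simp only [MarkedGraph.glue, Prod.snd_add, Multiset.map_add]
    congr 1
    · simp only [marked, graph, Multiset.map_map, Function.comp_apply, Sym2.map_map]
    · simp only [key]
      simp only [marked, graph, Multiset.map_map, Function.comp_apply, Sym2.map_map]

theorem graph_isomorphic_of_fst [Finite L] (D D' E : Multiset (Sym2 L))
    (h : ∀ i j, s(i, j) ∈ D → Quot.mk (Rel (D', E)) i = Quot.mk (Rel (D', E)) j)
    (h' : ∀ i j, s(i, j) ∈ D' → Quot.mk (Rel (D, E)) i = Quot.mk (Rel (D, E)) j) :
    (graph (D, E)).Isomorphic (graph (D', E)) :=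
  graph_isomorphic _ _ (Quot.mk _) h (Quot.lift (Quot.mk _) h') (fun _ => rfl) Quot.mk_surjective rfl

/-- Relabelling a presentation. -/
def map (φ : L → L') : Presentation L →+ Presentation L' :=
  (Multiset.mapAddMonoidHom (Sym2.map φ)).prodMap (Multiset.mapAddMonoidHom (Sym2.map φ))

@[simp]
theorem map_mk (φ : L → L') (D E : Multiset (Sym2 L)) :
    map φ (D, E) = (D.map (Sym2.map φ), E.map (Sym2.map φ)) := rfl

/-- The identifications of each label `w : W` with the label `b w : L`. -/
noncomputable def attach [Fintype W] (b : W → L) : Multiset (Sym2 (L ⊕ W)) :=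
  (Finset.univ : Finset W).val.map fun w => s(Sum.inl (b w), Sum.inr w)

theorem graph_attach_isomorphic [Finite L] [Fintype W] (b : W → L) (p : Presentation L)
    (E : Multiset (Sym2 W)) :
    (map Sum.inl p + (attach b, E.map (Sym2.map Sum.inr))).graph.Isomorphic
      (p + (0, E.map (Sym2.map b))).graph := by
  obtain ⟨D, E₀⟩ := p
  refine graph_isomorphic _ _ (fun x => Quot.mk _ (Sum.elim id b x)) ?_
    (Quot.map Sum.inl ?_) ?_ ?_ ?_
  · intro i j h
    rcases Multiset.mem_add.1 h with h | h
    · obtain ⟨e, he, h⟩ := Multiset.mem_map.1 h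
      have : Sym2.map (Sum.elim id b) s(i, j) = e := by
        rw [← h, Sym2.map_map]
        exact congrFun Sym2.map_id' e
      refine Quot.sound ?_
      simp only [Rel, Prod.mk_add_mk, add_zero]
      rw [← Sym2.map_mk, this]
      exact he
    · obtain ⟨w, -, h⟩ := Multiset.mem_map.1 h
      rcases Sym2.eq_iff.1 h with ⟨rfl, rfl⟩ | ⟨rfl, rfl⟩ <;> rfl
  · intro i j h
    simp only [Rel, Prod.mk_add_mk, add_zero] at h
    exact Multiset.mem_add.2 (Or.inl (Multiset.mem_map.2 ⟨_, h, rfl⟩))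
  · rintro (i | w)
    · rfl
    · exact Quot.sound (Multiset.mem_add.2 (Or.inr (Multiset.mem_map.2 ⟨w, Finset.mem_univ w, rfl⟩)))
  · rintro ⟨i⟩
    exact ⟨Sum.inl i, rfl⟩
  · simp only [graph, Prod.mk_add_mk, map_mk, Multiset.map_add, Multiset.map_map,
      Function.comp_apply, Sym2.map_map]
    rfl

theorem graph_inr_isomorphic [Finite L] [Finite W] (p : Presentation L) (E : Multiset (Sym2 W)) :
    (map Sum.inl p + (0, E.map (Sym2.map Sum.inr))).graph.Isomorphic
      ((p.marked Fin.elim0).glue ⟨⟨W, inferInstance, E⟩, Fin.elim0⟩) := by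
  obtain ⟨D, E₀⟩ := p
  refine graph_isomorphic _ _ (Sum.elim (fun i => Quot.mk _ (Sum.inl (Quot.mk _ i)))
    fun w => Quot.mk _ (Sum.inr w)) ?_
    (Quot.lift (Sum.elim (Quot.map Sum.inl ?_) fun w => Quot.mk _ (Sum.inr w)) ?_) ?_ ?_ ?_
  · intro i j h
    simp only [map_mk, Prod.mk_add_mk, add_zero, Multiset.mem_map] at h
    obtain ⟨e, he, h⟩ := h
    induction e with | _ a b
    have hab : Quot.mk (Rel (D, E₀)) a = Quot.mk _ b := Quot.sound he
    rcases Sym2.eq_iff.1 h with ⟨rfl, rfl⟩ | ⟨rfl, rfl⟩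
    · exact congrArg (fun x => Quot.mk _ (Sum.inl x)) hab
    · exact congrArg (fun x => Quot.mk _ (Sum.inl x)) hab.symm
  · intro i j h
    simp only [Rel, map_mk, Prod.mk_add_mk, add_zero]
    exact Multiset.mem_map.2 ⟨_, h, rfl⟩
  · rintro _ _ ⟨i⟩
    exact i.elim0
  · rintro (i | w) <;> rfl
  · rintro ⟨i | w⟩
    · obtain ⟨i, rfl⟩ := Quot.exists_rep i
      exact ⟨Sum.inl i, rfl⟩
    · exact ⟨Sum.inr w, rfl⟩
  · simp only [MarkedGraph.glue, marked, graph, Prod.mk_add_mk, map_mk, Multiset.map_add,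
      Multiset.map_map, Function.comp_apply, Sym2.map_map]
    rfl

end Presentation

/-! ### The algebra of labelled graphs modulo the radical -/

/-- Formal linear combinations of presented graphs. -/
abbrev QuantumGraph (L : Type) : Type := AddMonoidAlgebra ℂ (Presentation L)

namespace QuantumGraph

open AddMonoidAlgebra

variable {L L' W : Type}

/-- The linear extension of a function of graphs. -/
noncomputable def eval (f : Multigraph → ℂ) [Finite L] : QuantumGraph L →ₗ[ℂ] ℂ :=
  Finsupp.linearCombination ℂ (fun p : Presentation L => f p.graph) ∘ₗ
    (coeffLinearEquiv ℂ).toLinearMap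

@[simp]
theorem eval_single (f : Multigraph → ℂ) [Finite L] (p : Presentation L) (z : ℂ) :
    eval f (single p z) = z * f p.graph := by
  simp [eval]

/-- The radical of the bilinear form `(x, y) ↦ eval f (x * y)`. -/
noncomputable def null (f : Multigraph → ℂ) (L : Type) [Finite L] : Ideal (QuantumGraph L) where
  carrier := {x | ∀ y, eval f (x * y) = 0}
  add_mem' hx hy z := by rw [add_mul, map_add, hx, hy, add_zero]
  zero_mem' z := by simp
  smul_mem' c x hx z := by rw [smul_eq_mul, mul_comm c, mul_assoc, hx]

theorem eval_eq_of_mk_eq {f : Multigraph → ℂ} [Finite L] {x y : QuantumGraph L}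
    (h : Ideal.Quotient.mk (null f L) x = Ideal.Quotient.mk (null f L) y) :
    eval f x = eval f y := by
  have := Ideal.Quotient.eq.1 h 1
  rwa [mul_one, map_sub, sub_eq_zero] at this

/-- The identification of two labels. -/
noncomputable def ident (a b : L) : QuantumGraph L := single ({s(a, b)}, 0) 1

/-- The graph with the given edges. -/
noncomputable def ofEdges (E : Multiset (Sym2 L)) : QuantumGraph L := single (0, E) 1

theorem ident_comm (a b : L) : ident a b = ident b a := by
  rw [ident, ident, Sym2.eq_swap]

/-- Relabelling of quantum graphs. -/
noncomputable def map (φ : L → L') : QuantumGraph L →ₐ[ℂ] QuantumGraph L' :=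
  mapDomainAlgHom ℂ ℂ (Presentation.map φ)

@[simp]
theorem map_single (φ : L → L') (p : Presentation L) (z : ℂ) :
    map φ (single p z) = single (Presentation.map φ p) z := by
  simp [map]

@[simp]
theorem map_ident (φ : L → L') (a b : L) : map φ (ident a b) = ident (φ a) (φ b) := by
  simp [ident]

/-- The element that, up to the radical, makes the labels `a i` pairwise distinct. -/
noncomputable def sep : {k : ℕ} → (Fin k → L) → QuantumGraph L
  | 0, _ => 1
  | _ + 1, a => sep (a ∘ Fin.castSucc) * ∏ i, (1 - ident (a (Fin.castSucc i)) (a (Fin.last _)))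

@[simp]
theorem map_sep (φ : L → L') {k : ℕ} (a : Fin k → L) : map φ (sep a) = sep (φ ∘ a) := by
  induction k with
  | zero => simp [sep]
  | succ k ih => simp [sep, ih, Function.comp_assoc]

theorem one_sub_ident_dvd_sep {k : ℕ} (a : Fin k → L) {i j : Fin k} (h : i ≠ j) :
    1 - ident (a i) (a j) ∣ sep a := by
  induction k with
  | zero => exact i.elim0
  | succ k ih =>
    rw [sep]
    induction i using Fin.lastCases with
    | last =>
      induction j using Fin.lastCases with
      | last => exact absurd rfl h
      | cast j =>
        rw [ident_comm]
        exact (Finset.dvd_prod_of_mem _ (Finset.mem_univ j)).mul_left _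
    | cast i =>
      induction j using Fin.lastCases with
      | last => exact (Finset.dvd_prod_of_mem
          (fun i => 1 - ident (a (Fin.castSucc i)) (a (Fin.last _))) (Finset.mem_univ i)).mul_left _
      | cast j => exact (ih (a ∘ Fin.castSucc) fun hij => h (congrArg _ hij)).mul_right _

/-- The arbitrary `D₀` and `E` stand for a basis element to multiply by, since the radical tests
against all of them. -/
theorem mk_single_eq {f : Multigraph → ℂ} (hf : IsGraphInvariant f) [Finite L]
    (D D' : Multiset (Sym2 L))
    (h : ∀ (D₀ E : Multiset (Sym2 L)) (i j), s(i, j) ∈ D →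
      Quot.mk (Presentation.Rel (D' + D₀, E)) i = Quot.mk (Presentation.Rel (D' + D₀, E)) j)
    (h' : ∀ (D₀ E : Multiset (Sym2 L)) (i j), s(i, j) ∈ D' →
      Quot.mk (Presentation.Rel (D + D₀, E)) i = Quot.mk (Presentation.Rel (D + D₀, E)) j) :
    Ideal.Quotient.mk (null f L) (single (D, 0) 1) =
      Ideal.Quotient.mk (null f L) (single (D', 0) 1) := by
  refine Ideal.Quotient.eq.2 fun y => ?_
  induction y using induction_linear with
  | zero => simp
  | add x y hx hy => rw [mul_add, map_add, hx, hy, add_zero]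
  | single p z =>
    obtain ⟨D₀, E⟩ := p
    rw [sub_mul, single_mul_single, single_mul_single, map_sub, eval_single, eval_single,
      Prod.mk_add_mk, Prod.mk_add_mk, hf _ _ (Presentation.graph_isomorphic_of_fst _ _ _ ?_ ?_),
      sub_self]
    · intro i j hij
      rcases Multiset.mem_add.1 hij with hij | hij
      · exact h _ _ i j hij
      · exact Quot.sound (Multiset.mem_add.2 (Or.inr hij))
    · intro i j hij
      rcases Multiset.mem_add.1 hij with hij | hij
      · exact h' _ _ i j hij
      · exact Quot.sound (Multiset.mem_add.2 (Or.inr hij))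

theorem mk_ident_mul_self {f : Multigraph → ℂ} (hf : IsGraphInvariant f) [Finite L] (a b : L) :
    Ideal.Quotient.mk (null f L) (ident a b) * Ideal.Quotient.mk (null f L) (ident a b) =
      Ideal.Quotient.mk (null f L) (ident a b) := by
  rw [← map_mul, ident, single_mul_single, Prod.mk_add_mk, add_zero, one_mul]
  refine mk_single_eq hf _ _ (fun D₀ E i j h => ?_) fun D₀ E i j h => ?_ <;>
    exact Quot.sound (Multiset.mem_add.2 (Or.inl (by simpa using h)))

/-- By transitivity, `a = c` and `b = c` already imply `a = b`. -/
theorem mk_ident_mul_ident {f : Multigraph → ℂ} (hf : IsGraphInvariant f) [Finite L] (a b c : L) :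
    Ideal.Quotient.mk (null f L) ((1 - ident a b) * (ident a c * ident b c)) = 0 := by
  rw [sub_mul, one_mul, map_sub, sub_eq_zero, ident, ident, ident, single_mul_single,
    single_mul_single, one_mul, one_mul, Prod.mk_add_mk, Prod.mk_add_mk, add_zero, add_zero]
  refine mk_single_eq hf _ _ (fun D₀ E i j h => ?_) fun D₀ E i j h => ?_
  · exact Quot.sound (Multiset.mem_add.2 (Or.inl (Multiset.mem_add.2 (Or.inr h))))
  · rcases Multiset.mem_add.1 h with h | h
    · have hab : Quot.mk (Presentation.Rel ({s(a, c)} + {s(b, c)} + D₀, E)) a =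
          Quot.mk (Presentation.Rel ({s(a, c)} + {s(b, c)} + D₀, E)) b :=
        (Quot.sound (b := c) (by simp [Presentation.Rel])).trans
          (Quot.sound (b := c) (by simp [Presentation.Rel])).symm
      rcases Sym2.eq_iff.1 (Multiset.mem_singleton.1 h) with ⟨rfl, rfl⟩ | ⟨rfl, rfl⟩
      · exact hab
      · exact hab.symm
    · exact Quot.sound (Multiset.mem_add.2 (Or.inl h))

theorem mk_sep_mul_ident {f : Multigraph → ℂ} (hf : IsGraphInvariant f) [Finite L] {k : ℕ}
    (a : Fin k → L) {i j : Fin k} (h : i ≠ j) (w : L) :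
    Ideal.Quotient.mk (null f L) (sep a) * Ideal.Quotient.mk (null f L) (ident (a i) w) *
      Ideal.Quotient.mk (null f L) (ident (a j) w) = 0 := by
  obtain ⟨x, hx⟩ := one_sub_ident_dvd_sep a h
  rw [mul_assoc, hx, mul_comm _ x, ← map_mul, ← map_mul, mul_assoc, map_mul,
    mk_ident_mul_ident hf, mul_zero]

theorem prod_ident [Fintype W] (b : W → L) :
    ∏ w, ident (Sum.inl (b w)) (Sum.inr w : L ⊕ W) = single (Presentation.attach b, 0) 1 := by
  simp only [ident, prod_single, Finset.prod_const_one, Presentation.attach]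
  congr 1
  ext1
  · refine Eq.trans ?_ (Multiset.sum_map_singleton _)
    rw [Prod.fst_sum, Multiset.map_map]
    rfl
  · simp [Prod.snd_sum]

theorem eval_map_mul_prod_ident {f : Multigraph → ℂ} (hf : IsGraphInvariant f) [Finite L]
    [Fintype W] (x : QuantumGraph L) (b : W → L) (E : Multiset (Sym2 W)) :
    eval f (map Sum.inl x * (∏ w, ident (Sum.inl (b w)) (Sum.inr w)) *
      ofEdges (E.map (Sym2.map Sum.inr))) = eval f (x * ofEdges (E.map (Sym2.map b))) := by
  rw [prod_ident, ofEdges, ofEdges, mul_assoc, single_mul_single, Prod.mk_add_mk, add_zero,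
    zero_add, one_mul]
  induction x using induction_linear with
  | zero => simp
  | add x y hx hy => rw [map_add, add_mul, map_add, hx, hy, add_mul, map_add]
  | single p z =>
    rw [map_single, single_mul_single, single_mul_single, eval_single, eval_single,
      hf _ _ (Presentation.graph_attach_isomorphic b p E)]

theorem eval_map_mul_ofEdges {f : Multigraph → ℂ} (hf : IsGraphInvariant f)
    (hmul : ∀ G H : MarkedGraph 0, f (G.glue H) = f G.toMultigraph * f H.toMultigraph) [Finite L]
    [Finite W] (x : QuantumGraph L) (E : Multiset (Sym2 W)) :
    eval f (map Sum.inl x * ofEdges (E.map (Sym2.map Sum.inr))) =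
      eval f x * f ⟨W, inferInstance, E⟩ := by
  rw [ofEdges]
  induction x using induction_linear with
  | zero => simp
  | add x y hx hy => rw [map_add, add_mul, map_add, hx, hy, map_add, add_mul]
  | single p z =>
    rw [map_single, single_mul_single, eval_single, eval_single,
      hf _ _ (Presentation.graph_inr_isomorphic p E), hmul, mul_one, mul_assoc]
    rfl

end QuantumGraph

/-! ### Multiplicativity from `k = 0` -/

namespace MarkedGraph

/-- The graph without vertices as a `0`-marked graph. -/
def empty : MarkedGraph 0 := ⟨Multigraph.empty, Fin.elim0⟩

theorem glue_empty_isomorphic (G : MarkedGraph 0) : (G.glue empty).Isomorphic G.toMultigraph := by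
  refine ⟨⟨Quot.lift (Sum.elim id Empty.elim) ?_, fun v => Quot.mk _ (Sum.inl v), ?_, ?_⟩, ?_⟩
  · rintro _ _ ⟨i⟩
    exact i.elim0
  · rintro ⟨v | v⟩
    · rfl
    · exact v.elim
  · exact fun v => rfl
  · simp only [glue, empty, Multigraph.empty, Multiset.map_zero, add_zero, Multiset.map_map,
      Function.comp_apply, Sym2.map_map]
    exact (Multiset.map_congr rfl fun e _ => congrFun Sym2.map_id e).trans (Multiset.map_id _)

theorem empty_glue_isomorphic (G : MarkedGraph 0) : (empty.glue G).Isomorphic G.toMultigraph := by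
  refine ⟨⟨Quot.lift (Sum.elim Empty.elim id) ?_, fun v => Quot.mk _ (Sum.inr v), ?_, ?_⟩, ?_⟩
  · rintro _ _ ⟨i⟩
    exact i.elim0
  · rintro ⟨v | v⟩
    · exact v.elim
    · rfl
  · exact fun v => rfl
  · simp only [glue, empty, Multigraph.empty, Multiset.map_zero, zero_add, Multiset.map_map,
      Function.comp_apply, Sym2.map_map]
    exact (Multiset.map_congr rfl fun e _ => congrFun Sym2.map_id e).trans (Multiset.map_id _)

end MarkedGraph

theorem Matrix.finite_span_range_col_of_eRank_eq {m n : Type*} {A : Matrix m n ℂ} {r : ℕ}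
    (h : A.eRank = r) : Module.Finite ℂ (Submodule.span ℂ (Set.range A.col)) ∧
      Module.finrank ℂ (Submodule.span ℂ (Set.range A.col)) = r := by
  have h' : Module.rank ℂ (Submodule.span ℂ (Set.range A.col)) = r :=
    Cardinal.toENat_eq_natCast.1 h
  exact ⟨Module.finite_of_rank_eq_nat h', Module.finrank_eq_of_rank_eq h'⟩

/-- The column of the empty graph is `f` itself, nonzero as `f` is 1 there. Every column is thus a
multiple of `f`, with factor read off at the empty graph. -/
theorem map_glue_of_eRank_le_one {f : Multigraph → ℂ} (hf : IsGraphInvariant f)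
    (h1 : f Multigraph.empty = 1) {r : ℕ} (hr : (connectionMatrix f 0).eRank = r) (hr1 : r ≤ 1)
    (G H : MarkedGraph 0) : f (G.glue H) = f G.toMultigraph * f H.toMultigraph := by
  obtain ⟨hfin, hrank⟩ := Matrix.finite_span_range_col_of_eRank_eq hr
  obtain ⟨v, hv⟩ := finrank_le_one_iff.1 (hrank.trans_le hr1)
  obtain ⟨x, hx⟩ := hv ⟨_, Submodule.subset_span (Set.mem_range_self MarkedGraph.empty)⟩
  obtain ⟨y, hy⟩ := hv ⟨_, Submodule.subset_span (Set.mem_range_self H)⟩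
  have hx' : ∀ K : MarkedGraph 0, x * v.1 K = f K.toMultigraph := fun K =>
    (congrFun (congrArg Subtype.val hx) K).trans (hf _ _ K.glue_empty_isomorphic)
  have hy' : ∀ K : MarkedGraph 0, y * v.1 K = f (K.glue H) := fun K =>
    congrFun (congrArg Subtype.val hy) K
  have hxe := hx' MarkedGraph.empty
  have hye := (hy' MarkedGraph.empty).trans (hf _ _ H.empty_glue_isomorphic)
  replace hxe : x * v.1 MarkedGraph.empty = 1 := hxe.trans h1
  rw [← hx' G, ← hy' G, ← hye]
  linear_combination (-y * v.1 G) * hxe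

/-! ### Exponential rank growth bounds separation -/

namespace QuantumGraph

open AddMonoidAlgebra

variable {L W : Type}

/-- The combination of columns of the connection matrix given by a quantum graph. -/
noncomputable def column (f : Multigraph → ℂ) [Finite L] {k : ℕ} (e : Fin k ≃ L) :
    QuantumGraph L →ₗ[ℂ] MarkedGraph k → ℂ :=
  Finsupp.linearCombination ℂ (fun p : Presentation L =>
    (connectionMatrix f k).col (p.marked e)) ∘ₗ (coeffLinearEquiv ℂ).toLinearMap

/-- Evaluation of a function of marked graphs at a quantum graph. -/
noncomputable def pairing [Finite L] {k : ℕ} (e : Fin k ≃ L) :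
    QuantumGraph L →ₗ[ℂ] (MarkedGraph k → ℂ) →ₗ[ℂ] ℂ :=
  Finsupp.linearCombination ℂ (fun p : Presentation L => LinearMap.proj (p.marked e)) ∘ₗ
    (coeffLinearEquiv ℂ).toLinearMap

theorem column_mem (f : Multigraph → ℂ) [Finite L] {k : ℕ} (e : Fin k ≃ L) (x : QuantumGraph L) :
    column f e x ∈ Submodule.span ℂ (Set.range (connectionMatrix f k).col) := by
  simp only [column, LinearMap.comp_apply, Finsupp.linearCombination_apply]
  exact Submodule.sum_mem _ fun p _ =>
    Submodule.smul_mem _ _ (Submodule.subset_span (Set.mem_range_self _))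

theorem pairing_column {f : Multigraph → ℂ} (hf : IsGraphInvariant f) [Finite L] {k : ℕ}
    (e : Fin k ≃ L) (x y : QuantumGraph L) : pairing e x (column f e y) = eval f (x * y) := by
  induction x using induction_linear with
  | zero => simp
  | add x x' hx hx' => rw [map_add, LinearMap.add_apply, hx, hx', add_mul, map_add]
  | single p z =>
    induction y using induction_linear with
    | zero => simp
    | add x x' hx hx' => rw [map_add, map_add, hx, hx', mul_add, map_add]
    | single q z' =>
      rw [single_mul_single, eval_single, hf _ _ (Presentation.graph_add_isomorphic e p q)]
      simp [pairing, column, connectionMatrix, Matrix.col, mul_assoc, mul_left_comm]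

theorem card_le_of_eval_mul {f : Multigraph → ℂ} (hf : IsGraphInvariant f) [Finite L] {k r : ℕ}
    (e : Fin k ≃ L) (hr : (connectionMatrix f k).eRank = r) {ι : Type*} [Fintype ι]
    [DecidableEq ι] (u v : ι → QuantumGraph L) {t : ℂ} (ht : t ≠ 0)
    (h : ∀ i j, eval f (u i * v j) = if i = j then t else 0) : Fintype.card ι ≤ r := by
  have hli : LinearIndependent ℂ fun j => column f e (v j) := by
    refine Fintype.linearIndependent_iff.2 fun g hg i => ?_
    have := congrArg (pairing e (u i)) hg
    simp only [map_sum, map_smul, pairing_column hf, h, map_zero, smul_eq_mul, mul_ite, mul_zero,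
      Finset.sum_ite_eq, Finset.mem_univ, if_true] at this
    exact (mul_eq_zero.1 this).resolve_right ht
  obtain ⟨hfin, hrank⟩ := Matrix.finite_span_range_col_of_eRank_eq hr
  rw [← hrank, ← finrank_span_eq_card hli]
  refine Submodule.finrank_mono (Submodule.span_le.2 ?_)
  rintro _ ⟨j, rfl⟩
  exact column_mem f e (v j)

theorem pow_le_of_eval_sep_ne_zero {f : Multigraph → ℂ} (hf : IsGraphInvariant f) [Fintype L]
    {k : ℕ} (a : Fin k → L) (y : QuantumGraph L) (h : eval f (sep a * y) ≠ 0) (m : ℕ) {r : ℕ}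
    (hr : (connectionMatrix f (Fintype.card L + m)).eRank = r) : k ^ m ≤ r := by
  classical
  let b : (Fin m → Fin k) → QuantumGraph (L ⊕ Fin m) := fun φ =>
    ∏ w, ident (Sum.inl (a (φ w))) (Sum.inr w)
  have hsplit : map Sum.inl (sep a * y) = sep (Sum.inl ∘ a : Fin k → L ⊕ Fin m) *
      map Sum.inl y := by
    rw [map_mul, map_sep]
  have key := card_le_of_eval_mul hf
    ((Fintype.equivFinOfCardEq (by simp : Fintype.card (L ⊕ Fin m) = _)).symm) hr
    (fun φ => map Sum.inl (sep a * y) * b φ) b h fun φ ψ => ?_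
  · simpa using key
  split_ifs with hφ
  · subst hφ
    -- Attaching edgeless new vertices to old ones does not change the value, so every diagonal
    -- entry is `eval f (sep a * y)`.
    have h2 := eval_map_mul_prod_ident hf (sep a * y) (a ∘ φ) 0
    have h3 : (ofEdges 0 : QuantumGraph L) = 1 := rfl
    have h4 : (ofEdges 0 : QuantumGraph (L ⊕ Fin m)) = 1 := rfl
    rw [Multiset.map_zero, Multiset.map_zero, h3, h4, mul_one, mul_one] at h2
    rw [← h2]
    refine eval_eq_of_mk_eq ?_
    simp only [b, map_mul, map_prod, Function.comp_apply, mul_assoc]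
    simp only [← Finset.prod_mul_distrib, mk_ident_mul_self hf]
  -- Here `w` is tied to two distinct separated labels.
  · obtain ⟨w, hw⟩ := Function.ne_iff.1 hφ
    have hz := mk_sep_mul_ident hf (Sum.inl ∘ a : Fin k → L ⊕ Fin m) hw (Sum.inr w)
    rw [← map_zero (eval (L := L ⊕ Fin m) f)]
    refine eval_eq_of_mk_eq ?_
    have h1 : ident (Sum.inl (a (φ w))) (Sum.inr w) ∣ b φ :=
      Finset.dvd_prod_of_mem (fun w => ident (Sum.inl (a (φ w))) (Sum.inr w)) (Finset.mem_univ w)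
    have h2 : ident (Sum.inl (a (ψ w))) (Sum.inr w) ∣ b ψ :=
      Finset.dvd_prod_of_mem (fun w => ident (Sum.inl (a (ψ w))) (Sum.inr w)) (Finset.mem_univ w)
    obtain ⟨x1, hx1⟩ := h1
    obtain ⟨x2, hx2⟩ := h2
    rw [hsplit, hx1, hx2]
    simp only [map_mul, map_zero, Function.comp_apply] at hz ⊢
    linear_combination (Ideal.Quotient.mk (null f _) (map Sum.inl y) *
      Ideal.Quotient.mk (null f _) x1 * Ideal.Quotient.mk (null f _) x2) * hz

theorem exists_eval_sep_eq_zero {f : Multigraph → ℂ} (hf : IsGraphInvariant f) {c : ℝ}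
    (hc : ∀ k : ℕ, ∃ r : ℕ, (connectionMatrix f k).eRank = r ∧ (r : ℝ) ≤ c ^ k) :
    ∃ k : ℕ, ∀ (L : Type) [Finite L] (a : Fin k → L) (y : QuantumGraph L),
      eval f (sep a * y) = 0 := by
  -- `c` may be negative or below 1; the maximum gives a positive base. The fixed `|L|` contributes
  -- only a constant factor.
  obtain ⟨k, hk⟩ := exists_nat_gt (max |c| 1)
  refine ⟨k, fun L _ a y => ?_⟩
  by_contra h
  have := Fintype.ofFinite L
  set C := max |c| 1 with hC
  have hC0 : 0 < C := lt_max_of_lt_right one_pos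
  have hle : ∀ m : ℕ, (k / C) ^ m ≤ C ^ Fintype.card L := by
    intro m
    obtain ⟨r, hr, hrc⟩ := hc (Fintype.card L + m)
    have h1 : ((k ^ m : ℕ) : ℝ) ≤ r := Nat.cast_le.2 (pow_le_of_eval_sep_ne_zero hf a y h m hr)
    rw [div_pow, div_le_iff₀ (pow_pos hC0 m), ← pow_add]
    push_cast at h1
    calc (k : ℝ) ^ m ≤ c ^ (Fintype.card L + m) := h1.trans hrc
      _ ≤ |c| ^ (Fintype.card L + m) := (le_abs_self _).trans (abs_pow _ _).le
      _ ≤ C ^ (Fintype.card L + m) := pow_le_pow_left₀ (abs_nonneg c) (le_max_left _ _) _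
  obtain ⟨m, hm⟩ := pow_unbounded_of_one_lt (C ^ Fintype.card L) ((one_lt_div hC0).2 hk)
  exact absurd (hle m) hm.not_ge

end QuantumGraph

/-! ### Expansion over colourings -/

theorem mul_prod_one_sub_eq {B ι : Type*} [CommRing B] (q : B) (d : ι → B)
    (h : ∀ i j, i ≠ j → q * d i * d j = 0) (s : Finset ι) :
    q * ∏ i ∈ s, (1 - d i) = q * (1 - ∑ i ∈ s, d i) := by
  classical
  induction s using Finset.induction_on with
  | empty => simp
  | insert i s hi ih =>
    have h0 : (∑ j ∈ s, q * d i * d j) = 0 :=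
      Finset.sum_eq_zero fun j hj => h i j fun hij => hi (hij ▸ hj)
    rw [← Finset.mul_sum] at h0
    rw [Finset.prod_insert hi, Finset.sum_insert hi]
    linear_combination (1 - d i) * ih + h0

theorem mul_prod_eq_self {B ι : Type*} [CommMonoid B] (q : B) (d : ι → B)
    (h : ∀ i, q * d i = q) (s : Finset ι) : q * ∏ i ∈ s, d i = q := by
  classical
  induction s using Finset.induction_on with
  | empty => simp
  | insert i s hi ih => rw [Finset.prod_insert hi, ← mul_assoc, h, ih]

namespace QuantumGraph

open AddMonoidAlgebra

variable {L W : Type}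

theorem mk_sep_mul_sum {f : Multigraph → ℂ} (hf : IsGraphInvariant f) {n : ℕ}
    (hn : ∀ (L : Type) [Finite L] (a : Fin (n + 1) → L) (y : QuantumGraph L),
      eval f (sep a * y) = 0) [Finite L] (a : Fin n → L) (w : L) :
    Ideal.Quotient.mk (null f L) (sep a) * ∑ i, Ideal.Quotient.mk (null f L) (ident (a i) w) =
      Ideal.Quotient.mk (null f L) (sep a) := by
  -- Appending `w` makes a tuple too long to separate; orthogonality linearises its last factor.
  have h : Ideal.Quotient.mk (null f L) (sep (Fin.snoc a w : Fin (n + 1) → L)) = 0 :=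
    Ideal.Quotient.eq_zero_iff_mem.2 (hn L _)
  have ha : (Fin.snoc a w : Fin (n + 1) → L) ∘ Fin.castSucc = a := by
    funext i
    simp
  rw [sep, ha] at h
  simp only [Fin.snoc_castSucc, Fin.snoc_last, map_mul, map_prod, map_sub, map_one] at h
  rw [mul_prod_one_sub_eq _ _ fun i j hij => mk_sep_mul_ident hf a hij w] at h
  linear_combination -h

theorem sum_eval_sep_mul {f : Multigraph → ℂ} (hf : IsGraphInvariant f)
    (hmul : ∀ G H : MarkedGraph 0, f (G.glue H) = f G.toMultigraph * f H.toMultigraph) {n : ℕ}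
    (hn : ∀ (L : Type) [Finite L] (a : Fin (n + 1) → L) (y : QuantumGraph L),
      eval f (sep a * y) = 0) [Finite L] [Fintype W] [DecidableEq W] (a : Fin n → L)
    (y : QuantumGraph L) (E : Multiset (Sym2 W)) :
    ∑ κ : W → Fin n, eval f (sep a * y * ofEdges (E.map (Sym2.map (a ∘ κ)))) =
      eval f (sep a * y) * f ⟨W, inferInstance, E⟩ := by
  rw [← eval_map_mul_ofEdges hf hmul]
  rw [Finset.sum_congr rfl fun κ _ => (eval_map_mul_prod_ident hf (sep a * y) (a ∘ κ) E).symm,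
    ← map_sum]
  refine eval_eq_of_mk_eq ?_
  have h := mul_prod_eq_self _ _ (fun w : W =>
    mk_sep_mul_sum hf hn (Sum.inl ∘ a : Fin n → L ⊕ W) (Sum.inr w)) Finset.univ
  -- Distributing the product over `W` produces the sum over colourings `κ`.
  rw [Fintype.prod_sum] at h
  simp only [map_sum, map_mul, map_prod, map_sep, Function.comp_apply] at h ⊢
  rw [← Finset.sum_mul, ← Finset.mul_sum]
  linear_combination (Ideal.Quotient.mk (null f _) (map Sum.inl y) *
    Ideal.Quotient.mk (null f _) (ofEdges (E.map (Sym2.map Sum.inr)))) * h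

/-! ### Edge polynomials and the Nullstellensatz -/

theorem prod_map_ofEdges {ι : Type*} (E : Multiset ι) (g : ι → Sym2 L) :
    (E.map fun e => ofEdges {g e}).prod = ofEdges (E.map g) := by
  induction E using Multiset.induction_on with
  | empty => rfl
  | cons e E ih =>
    rw [Multiset.map_cons, Multiset.prod_cons, ih, Multiset.map_cons, ofEdges, ofEdges, ofEdges,
      single_mul_single, Prod.mk_add_mk, add_zero, one_mul, Multiset.singleton_add]

/-- The quantum graph obtained from a polynomial whose variables are the edges on `Fin n`. -/
noncomputable def ofPolynomial {n : ℕ} (a : Fin n → L) :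
    MvPolynomial (Sym2 (Fin n)) ℂ →ₐ[ℂ] QuantumGraph L :=
  MvPolynomial.aeval fun e => ofEdges {Sym2.map a e}

/-- The polynomials in the edges on `Fin n` that lie in the radical of the form
`(p, r) ↦ eval f (z * p * r)`. -/
noncomputable def nullPolynomials (f : Multigraph → ℂ) [Finite L] {n : ℕ} (a : Fin n → L)
    (z : QuantumGraph L) : Ideal (MvPolynomial (Sym2 (Fin n)) ℂ) where
  carrier := {p | ∀ r, eval f (z * ofPolynomial a (p * r)) = 0}
  add_mem' hp hq r := by rw [add_mul, map_add, mul_add, map_add, hp, hq, add_zero]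
  zero_mem' r := by simp
  smul_mem' c p hp r := by rw [smul_eq_mul, mul_comm c, mul_assoc, hp]

/-- The generic partition function. -/
noncomputable def partitionPolynomial (n : ℕ) [Fintype W] [DecidableEq W]
    (E : Multiset (Sym2 W)) : MvPolynomial (Sym2 (Fin n)) ℂ :=
  ∑ κ : W → Fin n, (E.map fun e => MvPolynomial.X (e.map κ)).prod

theorem partitionPolynomial_sub_mem {f : Multigraph → ℂ} (hf : IsGraphInvariant f)
    (hmul : ∀ G H : MarkedGraph 0, f (G.glue H) = f G.toMultigraph * f H.toMultigraph) {n : ℕ}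
    (hn : ∀ (L : Type) [Finite L] (a : Fin (n + 1) → L) (y : QuantumGraph L),
      eval f (sep a * y) = 0) [Finite L] [Fintype W] [DecidableEq W] (a : Fin n → L)
    (y : QuantumGraph L) (E : Multiset (Sym2 W)) :
    partitionPolynomial n E - MvPolynomial.C (f ⟨W, inferInstance, E⟩) ∈
      nullPolynomials f a (sep a * y) := by
  intro r
  have h := sum_eval_sep_mul hf hmul hn a (y * ofPolynomial a r) E
  have hκ : ∀ κ : W → Fin n, ofPolynomial a (E.map fun e => MvPolynomial.X (e.map κ)).prod =
      ofEdges (E.map (Sym2.map (a ∘ κ))) := by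
    intro κ
    rw [← prod_map_ofEdges, map_multiset_prod, Multiset.map_map]
    simp only [Function.comp_apply, ofPolynomial, MvPolynomial.aeval_X, Sym2.map_map]
  have hC : ofPolynomial a (MvPolynomial.C (f ⟨W, inferInstance, E⟩)) =
      algebraMap ℂ (QuantumGraph L) (f ⟨W, inferInstance, E⟩) := MvPolynomial.aeval_C _ _
  rw [map_mul (ofPolynomial a), map_sub (ofPolynomial a), hC, partitionPolynomial, map_sum]
  simp only [hκ]
  rw [sub_mul, mul_sub, map_sub, sub_eq_zero, Algebra.algebraMap_eq_smul_one, smul_mul_assoc,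
    one_mul, mul_smul_comm, map_smul, smul_eq_mul, mul_comm (f _), 
    mul_assoc (sep a) y (ofPolynomial a r), ← h,
    Finset.sum_mul, Finset.mul_sum, map_sum]
  refine Finset.sum_congr rfl fun κ _ => congrArg _ ?_
  ring

theorem exists_eq_eval_partitionPolynomial {f : Multigraph → ℂ} (hf : IsGraphInvariant f)
    (h1 : f Multigraph.empty = 1)
    (hmul : ∀ G H : MarkedGraph 0, f (G.glue H) = f G.toMultigraph * f H.toMultigraph)
    (hk : ∃ k : ℕ, ∀ (L : Type) [Finite L] (a : Fin k → L) (y : QuantumGraph L),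
      eval f (sep a * y) = 0) :
    ∃ (n : ℕ) (x : Sym2 (Fin n) → ℂ), ∀ (W : Type) [Fintype W] [DecidableEq W]
      (E : Multiset (Sym2 W)), f ⟨W, inferInstance, E⟩ =
        MvPolynomial.eval x (partitionPolynomial n E) := by
  classical
  -- The empty tuple has `sep` equal to 1, whose value on no labels is `f` of the empty graph.
  have hpos : Nat.find hk ≠ 0 := by
    intro h0
    have h := Nat.find_spec hk
    rw [h0] at h
    have h := h Empty Fin.elim0 1
    rw [mul_one, sep, one_def, eval_single, one_mul] at h
    refine one_ne_zero (h1.symm.trans (Eq.trans ?_ h))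
    refine (hf _ _ (Presentation.graph_isomorphic _ _ id ?_ Empty.elim ?_ ?_ ?_)).symm
    · exact fun i => i.elim
    · exact fun i => i.elim
    · exact Function.surjective_id
    · rfl
  obtain ⟨n, hn⟩ := Nat.exists_eq_succ_of_ne_zero hpos
  have hn1 := Nat.find_spec hk
  rw [hn] at hn1
  have hn0 := Nat.find_min hk (m := n) (by omega)
  push Not at hn0
  obtain ⟨L, _, a, y, hy⟩ := hn0
  have hJ : nullPolynomials f a (sep a * y) ≠ ⊤ := by
    intro h
    have h := (Ideal.eq_top_iff_one _).1 h 1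
    rw [mul_one, map_one, mul_one] at h
    exact hy h
  obtain ⟨M, hM, hJM⟩ := Ideal.exists_le_maximal _ hJ
  -- One point `x` kills the relations of all graphs at once.
  obtain ⟨x, rfl⟩ := MvPolynomial.isMaximal_iff_eq_vanishingIdeal_singleton.1 hM
  refine ⟨n, x, fun W _ _ E => ?_⟩
  have h := (MvPolynomial.mem_vanishingIdeal_singleton_iff x _).1
    (hJM (partitionPolynomial_sub_mem hf hmul hn1 a y E))
  rw [← MvPolynomial.coe_aeval_eq_eval]
  rw [map_sub, sub_eq_zero] at h
  simpa using h.symm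

end QuantumGraph

theorem exists_eq_partitionFunction {f : Multigraph → ℂ} (hf : IsGraphInvariant f)
    (h1 : f Multigraph.empty = 1) {c : ℝ}
    (hc : ∀ k : ℕ, ∃ r : ℕ, (connectionMatrix f k).eRank = r ∧ (r : ℝ) ≤ c ^ k) :
    ∃ (n : ℕ) (A : Matrix (Fin n) (Fin n) ℂ) (hA : A.IsSymm), f = partitionFunction hA := by
  classical
  obtain ⟨r, hr, hrc⟩ := hc 0
  rw [pow_zero, Nat.cast_le_one] at hrc
  obtain ⟨n, x, hx⟩ := QuantumGraph.exists_eq_eval_partitionPolynomial hf h1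
    (map_glue_of_eRank_le_one hf h1 hr hrc) (QuantumGraph.exists_eval_sep_eq_zero hf hc)
  have hA : (Matrix.of fun i j : Fin n => x s(i, j)).IsSymm := by
    ext i j
    simp [Sym2.eq_swap]
  refine ⟨n, _, hA, funext fun G => ?_⟩
  have hsym : hA.onSym2 = x := by
    funext e
    induction e with | _ i j
    rfl
  let : Fintype G.V := Fintype.ofFinite G.V
  refine (hx G.V G.edges).trans ?_
  simp only [QuantumGraph.partitionPolynomial, map_sum, map_multiset_prod, Multiset.map_map,
    Function.comp_apply, MvPolynomial.eval_X, partitionFunction, hsym]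

/-! ### Rank bound for partition functions -/

section PartitionFunction

variable {n : ℕ} {A : Matrix (Fin n) (Fin n) ℂ}

/-- The contribution of one colouring of the vertices to the partition function. -/
noncomputable def Multigraph.weight (hA : A.IsSymm) (G : Multigraph) (κ : G.V → Fin n) : ℂ :=
  (G.edges.map fun e => hA.onSym2 (e.map κ)).prod

theorem partitionFunction_eq_sum (hA : A.IsSymm) (G : Multigraph) [Fintype G.V]
    [DecidableEq G.V] : partitionFunction hA G = ∑ κ, G.weight hA κ := by
  unfold partitionFunction Multigraph.weight
  congr!

theorem partitionFunction_empty (hA : A.IsSymm) : partitionFunction hA Multigraph.empty = 1 := by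
  classical
  have : IsEmpty Multigraph.empty.V := inferInstanceAs (IsEmpty Empty)
  let : Fintype Multigraph.empty.V := Fintype.ofFinite _
  rw [partitionFunction_eq_sum]
  exact (Fintype.sum_eq_single isEmptyElim fun κ h => absurd (Subsingleton.elim _ _) h).trans
    Multiset.prod_zero

open Classical in
/-- The partition function of a marked graph with prescribed colours of the marks. -/
noncomputable def MarkedGraph.partitionFunction (hA : A.IsSymm) {k : ℕ} (θ : Fin k → Fin n)
    (G : MarkedGraph k) : ℂ :=
  letI : Fintype G.V := Fintype.ofFinite G.V
  ∑ κ : G.V → Fin n, if κ ∘ G.mark = θ then G.weight hA κ else 0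

theorem MarkedGraph.weight_glue (hA : A.IsSymm) {k : ℕ} (G H : MarkedGraph k)
    (κ : (G.glue H).V → Fin n) : (G.glue H).weight hA κ =
      G.weight hA (fun v => κ (Quot.mk _ (Sum.inl v))) *
        H.weight hA (fun v => κ (Quot.mk _ (Sum.inr v))) := by
  simp only [Multigraph.weight, MarkedGraph.glue, Multiset.map_add, Multiset.prod_add,
    Multiset.map_map, Function.comp_apply]
  exact congrArg₂ _
    (congrArg _ (Multiset.map_congr rfl fun _ _ => congrArg _ (Sym2.map_map ..)))
    (congrArg _ (Multiset.map_congr rfl fun _ _ => congrArg _ (Sym2.map_map ..)))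

theorem partitionFunction_glue (hA : A.IsSymm) {k : ℕ} (G H : MarkedGraph k) :
    partitionFunction hA (G.glue H) =
      ∑ θ : Fin k → Fin n, H.partitionFunction hA θ * G.partitionFunction hA θ := by
  classical
  let : Fintype G.V := Fintype.ofFinite G.V
  let : Fintype H.V := Fintype.ofFinite H.V
  let : Fintype (G.glue H).V := Fintype.ofFinite _
  have hR : ∑ θ : Fin k → Fin n, H.partitionFunction hA θ * G.partitionFunction hA θ =
      ∑ κ : (G.V → Fin n) × (H.V → Fin n), if κ.1 ∘ G.mark = κ.2 ∘ H.mark then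
        G.weight hA κ.1 * H.weight hA κ.2 else 0 := by
    simp only [MarkedGraph.partitionFunction, Finset.sum_mul_sum]
    rw [Fintype.sum_prod_type_right, Finset.sum_comm]
    refine Finset.sum_congr rfl fun κ₂ _ => ?_
    rw [Finset.sum_comm]
    refine Finset.sum_congr rfl fun κ₁ _ => ?_
    simp only [ite_mul, zero_mul]
    rw [Finset.sum_ite_eq, if_pos (Finset.mem_univ _), mul_ite, mul_zero, mul_comm]
  rw [hR, ← Finset.sum_filter, partitionFunction_eq_sum]
  refine Finset.sum_bij' (fun κ _ => (fun v => κ (Quot.mk _ (Sum.inl v)),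
      fun v => κ (Quot.mk _ (Sum.inr v))))
    (fun κ hκ => Quot.lift (Sum.elim κ.1 κ.2) ?_) ?_ ?_ ?_ ?_ ?_
  · rintro _ _ ⟨i⟩
    exact congrFun (Finset.mem_filter.1 hκ).2 i
  · intro κ _
    exact Finset.mem_filter.2 ⟨Finset.mem_univ _, funext fun i =>
      congrArg κ (Quot.sound (MarkedGraph.SameMark.intro i))⟩
  · exact fun _ _ => Finset.mem_univ _
  · intro κ _
    funext v
    obtain ⟨v | v, rfl⟩ := Quot.exists_rep v <;> rfl
  · exact fun _ _ => rfl
  · exact fun κ _ => MarkedGraph.weight_glue hA G H κ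

theorem exists_eRank_connectionMatrix_partitionFunction (hA : A.IsSymm) (k : ℕ) :
    ∃ r : ℕ, (connectionMatrix (partitionFunction hA) k).eRank = r ∧ r ≤ n ^ k := by
  let g : (Fin k → Fin n) → MarkedGraph k → ℂ := fun θ G => G.partitionFunction hA θ
  have hle : Submodule.span ℂ (Set.range (connectionMatrix (partitionFunction hA) k).col) ≤
      Submodule.span ℂ (Set.range g) := by
    refine Submodule.span_le.2 ?_
    rintro _ ⟨H, rfl⟩
    have : (connectionMatrix (partitionFunction hA) k).col H =
        ∑ θ, H.partitionFunction hA θ • g θ := by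
      funext G
      simp only [Finset.sum_apply, Pi.smul_apply, smul_eq_mul]
      exact partitionFunction_glue hA G H
    rw [this]
    exact Submodule.sum_mem _ fun θ _ =>
      Submodule.smul_mem _ _ (Submodule.subset_span (Set.mem_range_self θ))
  have hfin : Module.Finite ℂ (Submodule.span ℂ (Set.range g)) :=
    FiniteDimensional.span_of_finite ℂ (Set.finite_range g)
  have hfin' := Submodule.finiteDimensional_of_le hle
  refine ⟨Module.finrank ℂ (Submodule.span ℂ
    (Set.range (connectionMatrix (partitionFunction hA) k).col)), ?_, ?_⟩
  · rw [Matrix.eRank, Matrix.cRank, ← Module.finrank_eq_rank]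
    simp
  · refine (Submodule.finrank_mono hle).trans ((finrank_range_le_card g).trans ?_)
    simp

end PartitionFunction

theorem theorem1 (f : Multigraph → ℂ) (hf : IsGraphInvariant f) :
    (∃ (n : ℕ) (A : Matrix (Fin n) (Fin n) ℂ) (hA : A.IsSymm), f = partitionFunction hA) ↔
      f Multigraph.empty = 1 ∧
        ∃ c : ℝ, ∀ k : ℕ, ∃ r : ℕ, (connectionMatrix f k).eRank = r ∧ (r : ℝ) ≤ c ^ k := by
  constructor
  · rintro ⟨n, A, hA, rfl⟩
    refine ⟨partitionFunction_empty hA, n, fun k => ?_⟩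
    obtain ⟨r, hr, hrn⟩ := exists_eRank_connectionMatrix_partitionFunction hA k
    exact ⟨r, hr, by exact_mod_cast hrn⟩
  · rintro ⟨h1, c, hc⟩
    exact exists_eq_partitionFunction hf h1 hc
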